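/- For a non-empty open set $\Omega\subseteq\mathbb{R}^d$ let $H^1(\Omega)$ be the space of all complex-valued $f\in L^2(\Omega)$ whose weak first-order partial derivatives $\partial_1 f,\dots,\partial_d f$ exist in $L^2(\Omega)$, with the norm \[ \|f\|_1^2=\sum_{i=1}^d\|\partial_i f\|_{L^2(\Omega)}^2+\|f\|_{L^2(\Omega)}^2 . \] An extension operator for $\Omega$ is a linear operator $E\colon H^1(\Omega)\to H^1(\mathbb{R}^d)$ such that $(Ef)|_\Omega=f$ for all $f\in H^1(\Omega)$ and $\|E\|_1:=\sup_{\|f\|_1=1}\|Ef\|_1<\infty$. Put $\mathcal{E}(\Omega):=\inf_E\|E\|_1\in[0,\infty]$, the infimum being taken over all extension operators $E$ for $\Omega$ (with $\inf\emptyset=\infty$). **Proposition.** Let $a,b>0$ and let $\Pi_{a,b}=(0,a)\times(0,b)\subset\mathbb{R}^2$. Then \[ \mathcal{E}(\Pi_{a,b})\ \ge\ \sqrt{1+2\Big(\frac1a+\frac1b\Big)} , \] that is, every extension operator $E$ for $\Pi_{a,b}$ satisfies $\|E\|_1\ge\sqrt{1+2\left(\frac1a+\frac1b\right)}$. -/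

import Mathlib

open MeasureTheory
open scoped ENNReal ContDiff

/-- The Lebesgue space `L²(Ω)` of complex-valued functions on `Ω ⊆ ℝᵈ`. -/
abbrev L2 {d : ℕ} (Ω : Set (EuclideanSpace ℝ (Fin d))) : Type :=
  Lp ℂ 2 (volume.restrict Ω)

/-- `φ ∈ C_c^∞(Ω)`: a smooth (real-valued) test function with compact support in `Ω`. -/
structure IsTestFunction {d : ℕ} (Ω : Set (EuclideanSpace ℝ (Fin d)))
    (φ : EuclideanSpace ℝ (Fin d) → ℝ) : Prop where
  contDiff : ContDiff ℝ ∞ φ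
  hasCompactSupport : HasCompactSupport φ
  tsupport_subset : tsupport φ ⊆ Ω

/-- The classical partial derivative `∂ᵢ φ`. -/
noncomputable def partialDeriv {d : ℕ} (i : Fin d) (φ : EuclideanSpace ℝ (Fin d) → ℝ)
    (x : EuclideanSpace ℝ (Fin d)) : ℝ :=
  fderiv ℝ φ x (EuclideanSpace.single i 1)

/-- `g ∈ L²(Ω)` is the weak `i`-th partial derivative of `f ∈ L²(Ω)`:
`∫_Ω (∂ᵢ φ) f = - ∫_Ω φ g` for every test function `φ`. -/
def HasWeakDeriv {d : ℕ} (Ω : Set (EuclideanSpace ℝ (Fin d))) (i : Fin d) (f g : L2 Ω) : Prop :=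
  ∀ φ : EuclideanSpace ℝ (Fin d) → ℝ, IsTestFunction Ω φ →
    ∫ x in Ω, partialDeriv i φ x • f x = - ∫ x in Ω, φ x • g x

theorem IsTestFunction.integrable_smul {d : ℕ} {Ω : Set (EuclideanSpace ℝ (Fin d))}
    {φ : EuclideanSpace ℝ (Fin d) → ℝ} (hφ : IsTestFunction Ω φ) (f : L2 Ω) :
    Integrable (fun x => φ x • f x) (volume.restrict Ω) := by
  have h1 : MemLp φ 2 (volume.restrict Ω) :=
    hφ.contDiff.continuous.memLp_of_hasCompactSupport hφ.hasCompactSupport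
  exact memLp_one_iff_integrable.mp ((Lp.memLp f).smul h1)

theorem IsTestFunction.integrable_partialDeriv_smul {d : ℕ}
    {Ω : Set (EuclideanSpace ℝ (Fin d))}
    {φ : EuclideanSpace ℝ (Fin d) → ℝ} (hφ : IsTestFunction Ω φ) (i : Fin d) (f : L2 Ω) :
    Integrable (fun x => partialDeriv i φ x • f x) (volume.restrict Ω) := by
  have hc : Continuous (partialDeriv i φ) :=
    (hφ.contDiff.continuous_fderiv (by simp)).clm_apply continuous_const
  have hs : HasCompactSupport (partialDeriv i φ) :=
    hφ.hasCompactSupport.fderiv_apply ℝ (EuclideanSpace.single i 1)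
  have h1 : MemLp (partialDeriv i φ) 2 (volume.restrict Ω) :=
    hc.memLp_of_hasCompactSupport hs
  exact memLp_one_iff_integrable.mp ((Lp.memLp f).smul h1)

theorem HasWeakDeriv.zero {d : ℕ} (Ω : Set (EuclideanSpace ℝ (Fin d))) (i : Fin d) :
    HasWeakDeriv Ω i 0 0 := by
  intro φ _
  have h : ∀ ψ : EuclideanSpace ℝ (Fin d) → ℝ,
      ∫ x in Ω, ψ x • (0 : L2 Ω) x = 0 := by
    intro ψ
    refine integral_eq_zero_of_ae ?_
    filter_upwards [Lp.coeFn_zero ℂ 2 (volume.restrict Ω)] with x hx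
    rw [hx]
    exact smul_zero _
  rw [h, h, neg_zero]

theorem HasWeakDeriv.add {d : ℕ} {Ω : Set (EuclideanSpace ℝ (Fin d))} {i : Fin d}
    {f₁ g₁ f₂ g₂ : L2 Ω} (h₁ : HasWeakDeriv Ω i f₁ g₁) (h₂ : HasWeakDeriv Ω i f₂ g₂) :
    HasWeakDeriv Ω i (f₁ + f₂) (g₁ + g₂) := by
  intro φ hφ
  have h : ∀ (ψ : EuclideanSpace ℝ (Fin d) → ℝ) (u v : L2 Ω),
      ∫ x in Ω, ψ x • (u + v) x = ∫ x in Ω, (ψ x • u x + ψ x • v x) := by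
    intro ψ u v
    refine integral_congr_ae ?_
    filter_upwards [Lp.coeFn_add u v] with x hx
    simp only [hx, Pi.add_apply, smul_add]
  rw [h, h, integral_add (hφ.integrable_partialDeriv_smul i f₁)
    (hφ.integrable_partialDeriv_smul i f₂),
    integral_add (hφ.integrable_smul g₁) (hφ.integrable_smul g₂), h₁ φ hφ, h₂ φ hφ, neg_add]

theorem HasWeakDeriv.const_smul {d : ℕ} {Ω : Set (EuclideanSpace ℝ (Fin d))} {i : Fin d}
    {f g : L2 Ω} (hfg : HasWeakDeriv Ω i f g) (c : ℂ) :
    HasWeakDeriv Ω i (c • f) (c • g) := by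
  intro φ hφ
  have h : ∀ (ψ : EuclideanSpace ℝ (Fin d) → ℝ) (u : L2 Ω),
      ∫ x in Ω, ψ x • (c • u) x = c • ∫ x in Ω, ψ x • u x := by
    intro ψ u
    rw [← integral_smul]
    refine integral_congr_ae ?_
    filter_upwards [Lp.coeFn_smul c u] with x hx
    simp only [hx, Pi.smul_apply]
    rw [smul_comm]
  rw [h, h, hfg φ hφ, smul_neg]

/-- On an open set the weak derivative is unique. -/
theorem HasWeakDeriv.unique {d : ℕ} {Ω : Set (EuclideanSpace ℝ (Fin d))} (hΩ : IsOpen Ω)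
    {i : Fin d} {f g₁ g₂ : L2 Ω} (h₁ : HasWeakDeriv Ω i f g₁) (h₂ : HasWeakDeriv Ω i f g₂) :
    g₁ = g₂ := by
  have hloc : LocallyIntegrableOn (fun x => g₁ x - g₂ x) Ω :=
    locallyIntegrableOn_of_locallyIntegrable_restrict
      (((Lp.memLp g₁).sub (Lp.memLp g₂)).locallyIntegrable one_le_two)
  have key := hΩ.ae_eq_zero_of_integral_contDiff_smul_eq_zero hloc (by
    intro φ hφ hc hs
    have ht : IsTestFunction Ω φ := ⟨hφ, hc, hs⟩
    have hset : ∫ x, φ x • (g₁ x - g₂ x) = ∫ x in Ω, φ x • (g₁ x - g₂ x) := by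
      refine (setIntegral_eq_integral_of_forall_compl_eq_zero fun x hx => ?_).symm
      rw [image_eq_zero_of_notMem_tsupport fun h => hx (hs h), zero_smul]
    rw [hset]
    simp only [smul_sub]
    rw [integral_sub (ht.integrable_smul g₁) (ht.integrable_smul g₂), sub_eq_zero]
    exact neg_injective ((h₁ φ ht).symm.trans (h₂ φ ht)))
  refine Lp.ext ?_
  rw [Filter.EventuallyEq, ae_restrict_iff' hΩ.measurableSet]
  filter_upwards [key] with x hx hxΩ
  exact sub_eq_zero.mp (hx hxΩ)

/-- The Sobolev space `H¹(Ω)` (for open `Ω ⊆ ℝᵈ`): all `f ∈ L²(Ω)` whose weak first-order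
partial derivatives exist in `L²(Ω)`. -/
def H1 {d : ℕ} (Ω : Set (EuclideanSpace ℝ (Fin d))) : Submodule ℂ (L2 Ω) where
  carrier := {f | ∀ i : Fin d, ∃ g : L2 Ω, HasWeakDeriv Ω i f g}
  zero_mem' := fun i => ⟨0, HasWeakDeriv.zero Ω i⟩
  add_mem' := fun {_ _} hf hg i => by
    obtain ⟨u, hu⟩ := hf i
    obtain ⟨v, hv⟩ := hg i
    exact ⟨u + v, hu.add hv⟩
  smul_mem' := fun c _ hf i => by
    obtain ⟨u, hu⟩ := hf i
    exact ⟨c • u, hu.const_smul c⟩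

/-- The weak partial derivative `∂ᵢ f ∈ L²(Ω)` of `f ∈ H¹(Ω)`. -/
noncomputable def weakDeriv {d : ℕ} {Ω : Set (EuclideanSpace ℝ (Fin d))} (f : H1 Ω)
    (i : Fin d) : L2 Ω :=
  (f.2 i).choose

theorem hasWeakDeriv_weakDeriv {d : ℕ} {Ω : Set (EuclideanSpace ℝ (Fin d))} (f : H1 Ω)
    (i : Fin d) : HasWeakDeriv Ω i f (weakDeriv f i) :=
  (f.2 i).choose_spec

/-- The norm of `H¹(Ω)`: `‖f‖₁² = ‖∇f‖²_{L²(Ω; ℂᵈ)} + ‖f‖²_{L²(Ω)}`.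
(The norm symbol on `H1 Ω` itself denotes the `L²`-norm.) -/
noncomputable def h1Norm {d : ℕ} {Ω : Set (EuclideanSpace ℝ (Fin d))} (f : H1 Ω) : ℝ :=
  Real.sqrt ((∑ i : Fin d, ‖weakDeriv f i‖ ^ 2) + ‖(f : L2 Ω)‖ ^ 2)

/-- The operator norm `‖E‖₁ = sup_{‖f‖₁ = 1} ‖E f‖₁ ∈ [0, ∞]` of a linear operator
`E : H¹(Ω) → H¹(ℝᵈ)`. -/
noncomputable def h1OpNorm {d : ℕ} {Ω : Set (EuclideanSpace ℝ (Fin d))}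
    (E : H1 Ω →ₗ[ℂ] H1 (Set.univ : Set (EuclideanSpace ℝ (Fin d)))) : ℝ≥0∞ :=
  ⨆ (f : H1 Ω) (_ : h1Norm f = 1), ENNReal.ofReal (h1Norm (E f))

/-- An extension operator for `Ω`: a linear operator `E : H¹(Ω) → H¹(ℝᵈ)` with
`(E f)|_Ω = f` for all `f` and `‖E‖₁ < ∞`. -/
structure IsExtensionOperator {d : ℕ} (Ω : Set (EuclideanSpace ℝ (Fin d)))
    (E : H1 Ω →ₗ[ℂ] H1 (Set.univ : Set (EuclideanSpace ℝ (Fin d)))) : Prop where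
  restrict_eq : ∀ f : H1 Ω,
    ((E f : L2 (Set.univ : Set (EuclideanSpace ℝ (Fin d)))) : EuclideanSpace ℝ (Fin d) → ℂ)
      =ᵐ[volume.restrict Ω] (f : L2 Ω)
  norm_lt_top : h1OpNorm E < ⊤

/-- The minimal norm `𝓔(Ω) = inf_E ‖E‖₁` over all extension operators `E` for `Ω`
(equal to `∞` if there is none). -/
noncomputable def minExtensionNorm {d : ℕ} (Ω : Set (EuclideanSpace ℝ (Fin d))) : ℝ≥0∞ :=
  ⨅ (E : H1 Ω →ₗ[ℂ] H1 (Set.univ : Set (EuclideanSpace ℝ (Fin d))))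
    (_ : IsExtensionOperator Ω E), h1OpNorm E

/-- The open rectangle `(0, a) × (0, b) ⊆ ℝ²`. -/
def openRectangle (a b : ℝ) : Set (EuclideanSpace ℝ (Fin 2)) :=
  {x | x 0 ∈ Set.Ioo 0 a ∧ x 1 ∈ Set.Ioo 0 b}

/-! Test an extension operator on the constant `c` with `c² a b = 1`, which has norm 1. Along any
line parallel to an axis and crossing the rectangle, the extension leaves it at height `c` on both
sides. On each half-line the cheapest continuation is `c * exp (-dist)`, of energy `c²`. Integrating
over the crossing lines gives `2 b c²` for the two horizontal half-strips and `2 a c²` for the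
vertical ones. With the mass 1 on the rectangle, the squared norm is at least `1 + 2 (a + b) / (a
b)`.

To avoid traces and restriction to lines, the half-line bound is obtained by duality
(`mul_setIntegral_le_strip_energy`): the weak derivative identity is tested on `s (x i) * η (x j)`,
where outside the interval `s` is close to minus the derivative of the optimal continuation of 1
(`exists_profile`) and `η` approximates the indicator of the cross-section (`exists_cutoff`). -/

/-! ### One-dimensional profiles and cutoffs -/

/-- Truncating an exponential by a slowly varying cutoff barely raises its energy density: the
derivative only gains the term with `χ'`. -/
theorem sq_add_deriv_sq_le_of_eventuallyEq {s χ : ℝ → ℝ} {x χ' κ σ τ c : ℝ}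
    (hχ : HasDerivAt χ χ' x) (h1 : |χ x| ≤ 1) (hκ : |χ'| ≤ κ) (hσ : σ ^ 2 = 1) (hτ : |τ| = 1)
    (hs : s =ᶠ[nhds x] fun y => σ * (χ y * Real.exp (τ * y + c))) :
    s x ^ 2 + deriv s x ^ 2 ≤ (1 + (1 + κ) ^ 2) * Real.exp (2 * (τ * x + c)) := by
  have hd : HasDerivAt (fun y => σ * (χ y * Real.exp (τ * y + c)))
      (σ * (χ' * Real.exp (τ * x + c) + χ x * (Real.exp (τ * x + c) * τ))) x := by
    have h2 : HasDerivAt (fun y => τ * y + c) τ x := by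
      simpa using ((hasDerivAt_id x).const_mul τ).add_const c
    exact (hχ.mul h2.exp).const_mul σ
  rw [hs.deriv_eq, hd.deriv, hs.eq_of_nhds]
  have hE : Real.exp (2 * (τ * x + c)) = Real.exp (τ * x + c) ^ 2 := by
    rw [← Real.exp_nat_mul]; norm_num
  have hb : |χ' + χ x * τ| ≤ 1 + κ := by
    refine (abs_add_le _ _).trans ?_
    rw [abs_mul, hτ]
    linarith
  have hb2 : (χ' + χ x * τ) ^ 2 ≤ (1 + κ) ^ 2 := by
    rw [← sq_abs]; gcongr
  have hc2 : χ x ^ 2 ≤ 1 := by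
    rw [← sq_abs]; exact pow_le_one₀ (abs_nonneg _) h1
  rw [hE]
  calc _ = σ ^ 2 * ((χ x ^ 2 + (χ' + χ x * τ) ^ 2) * Real.exp (τ * x + c) ^ 2) := by ring
    _ ≤ _ := by rw [hσ, one_mul]; gcongr

/-- Almost minimisers of `∫ s² + s'²` outside `(0, l)` among functions with jump `2` across
`(0, l)`. -/
theorem exists_profile {l ε : ℝ} (hl : 0 < l) (hε : 0 < ε) :
    ∃ s : ℝ → ℝ, ContDiff ℝ ∞ s ∧ HasCompactSupport s ∧ s l - s 0 = 2 ∧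
      ∫ x in (Set.Ioo 0 l)ᶜ, (s x ^ 2 + deriv s x ^ 2) ≤ 2 + ε := by
  let g : ContDiffBump (0 : ℝ) := ⟨1, 2, one_pos, one_lt_two⟩
  have hgc : ContDiff ℝ ∞ g := g.contDiff
  obtain ⟨C, hC⟩ := (g.hasCompactSupport.deriv).exists_bound_of_continuous
    (hgc.continuous_deriv (by simp))
  have hC0 : 0 ≤ C := (norm_nonneg _).trans (hC 0)
  -- The bound `1 / l` keeps `χ = 1` at both `0` and `l`, so the jump is exact. The other bound
  -- gives `κ = δ * C ≤ min 1 (ε / 3)`, hence `1 + (1 + κ)² ≤ 2 + 3 κ ≤ 2 + ε`, the final estimate.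
  let δ : ℝ := min (1 / l) (min 1 (ε / 3) / (C + 1))
  have hδ : 0 < δ := by positivity
  have hδl : δ * l ≤ 1 := by
    calc δ * l ≤ 1 / l * l := by gcongr; exact min_le_left _ _
      _ = 1 := by field_simp
  have hκ : δ * C ≤ min 1 (ε / 3) := by
    calc δ * C ≤ δ * (C + 1) := by gcongr; linarith
      _ ≤ min 1 (ε / 3) / (C + 1) * (C + 1) := by gcongr; exact min_le_right _ _
      _ = _ := by field_simp
  have hκ1 := hκ.trans (min_le_left _ _)
  have hκ2 := hκ.trans (min_le_right _ _)
  have hκ0 : 0 ≤ δ * C := by positivity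
  let χ : ℝ → ℝ := fun x => g (δ * x)
  have hχ : ContDiff ℝ ∞ χ := hgc.comp (contDiff_const.mul contDiff_id)
  have hχd (x : ℝ) : HasDerivAt χ (deriv g (δ * x) * δ) x := by
    have h2 : HasDerivAt (fun y => δ * y) δ x := by
      simpa using (hasDerivAt_id x).const_mul δ
    exact ((hgc.differentiable (by simp) (δ * x)).hasDerivAt).comp x h2
  have hχb (x : ℝ) : |χ x| ≤ 1 := by
    rw [abs_of_nonneg g.nonneg]; exact g.le_one
  have hχ' (x : ℝ) : |deriv g (δ * x) * δ| ≤ δ * C := by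
    rw [abs_mul, abs_of_pos hδ, mul_comm]
    gcongr
    exact hC _
  let T : ℝ → ℝ := fun x => Real.smoothTransition (x / l)
  have hT : ContDiff ℝ ∞ T := Real.smoothTransition.contDiff.comp (contDiff_id.div_const l)
  -- Only the values outside `(0, l)` enter the energy; inside, any smooth transition serves.
  let m : ℝ → ℝ := fun x => Real.exp (l - x) * T x - Real.exp x * (1 - T x)
  have hm : ContDiff ℝ ∞ m :=
    ((Real.contDiff_exp.comp (contDiff_const.sub contDiff_id)).mul hT).sub
      (Real.contDiff_exp.mul (contDiff_const.sub hT))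
  have hmr {x : ℝ} (hx : l ≤ x) : m x = Real.exp (l - x) := by
    have : T x = 1 := Real.smoothTransition.one_of_one_le (by rwa [le_div_iff₀ hl, one_mul])
    simp [m, this]
  have hml {x : ℝ} (hx : x ≤ 0) : m x = - Real.exp x := by
    have : T x = 0 := Real.smoothTransition.zero_of_nonpos (div_nonpos_of_nonpos_of_nonneg hx hl.le)
    simp [m, this]
  let s : ℝ → ℝ := fun x => χ x * m x
  have hs : ContDiff ℝ ∞ s := hχ.mul hm
  have hsc : HasCompactSupport s :=
    (g.hasCompactSupport.comp_homeomorph (Homeomorph.mulLeft₀ δ hδ.ne')).mul_right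
  have hint : Integrable fun x => s x ^ 2 + deriv s x ^ 2 :=
    (hs.continuous.memLp_of_hasCompactSupport hsc).integrable_sq.add
      ((hs.continuous_deriv (by simp)).memLp_of_hasCompactSupport hsc.deriv).integrable_sq
  refine ⟨s, hs, hsc, ?_, ?_⟩
  · have h0 : χ 0 = 1 := g.one_of_mem_closedBall (by simp [g])
    have h1 : χ l = 1 := g.one_of_mem_closedBall (by
      simpa [g, abs_of_pos hδ, abs_of_pos hl] using hδl)
    simp only [s, h0, h1, hmr le_rfl, hml le_rfl]
    norm_num
  · have hset : (Set.Ioo 0 l)ᶜ = Set.Iic 0 ∪ Set.Ici l := by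
      ext x; simp only [Set.mem_compl_iff, Set.mem_Ioo, Set.mem_union, Set.mem_Iic, Set.mem_Ici]
      grind
    rw [hset, setIntegral_union (Set.disjoint_left.2 fun x hx hx' => by
      simp only [Set.mem_Iic, Set.mem_Ici] at hx hx'; linarith) measurableSet_Ici
      hint.integrableOn hint.integrableOn, integral_Ici_eq_integral_Ioi,
      integral_Iic_eq_integral_Iio]
    have hR : ∫ x in Set.Ioi l, (s x ^ 2 + deriv s x ^ 2) ≤ (1 + (1 + δ * C) ^ 2) / 2 := by
      calc _ ≤ ∫ x in Set.Ioi l, (1 + (1 + δ * C) ^ 2) * Real.exp (2 * l) * Real.exp (-2 * x) := by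
            refine setIntegral_mono_on hint.integrableOn
              ((integrableOn_exp_mul_Ioi (by norm_num) l).const_mul _) measurableSet_Ioi
              fun x hx => ?_
            refine (sq_add_deriv_sq_le_of_eventuallyEq (χ := χ) (σ := 1) (τ := -1) (c := l)
              (hχd x) (hχb x) (hχ' x) (by simp) (by simp) ?_).trans_eq ?_
            · filter_upwards [Ioi_mem_nhds hx] with y hy
              simp only [s, hmr (le_of_lt hy)]
              ring_nf
            · rw [mul_assoc, ← Real.exp_add]; ring_nf
        _ = _ := by
            rw [integral_const_mul, integral_exp_mul_Ioi (by norm_num)]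
            rw [mul_assoc, mul_div_assoc', mul_neg, ← Real.exp_add]
            ring_nf
            simp; ring
    have hL : ∫ x in Set.Iio 0, (s x ^ 2 + deriv s x ^ 2) ≤ (1 + (1 + δ * C) ^ 2) / 2 := by
      calc _ ≤ ∫ x in Set.Iio 0, (1 + (1 + δ * C) ^ 2) * Real.exp (2 * x) := by
            refine setIntegral_mono_on hint.integrableOn
              (((integrableOn_exp_mul_Iic (by norm_num) 0).mono_set Set.Iio_subset_Iic_self).const_mul
                _) measurableSet_Iio fun x hx => ?_
            refine (sq_add_deriv_sq_le_of_eventuallyEq (χ := χ) (σ := -1) (τ := 1) (c := 0)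
              (hχd x) (hχb x) (hχ' x) (by simp) (by simp) ?_).trans_eq ?_
            · filter_upwards [Iio_mem_nhds hx] with y hy
              simp only [s, hml (le_of_lt hy)]
              ring_nf
            · ring_nf
        _ = _ := by
            rw [integral_const_mul, ← integral_Iic_eq_integral_Iio,
              integral_exp_mul_Iic (by norm_num)]
            simp; ring
    nlinarith

/-- A smooth cutoff in `(0, l)` with integral close to `l`. -/
theorem exists_cutoff {l ε : ℝ} (hl : 0 < l) (hε : 0 < ε) :
    ∃ η : ℝ → ℝ, ContDiff ℝ ∞ η ∧ HasCompactSupport η ∧ (∀ x, 0 ≤ η x) ∧ (∀ x, η x ≤ 1) ∧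
      (∀ x, x ∉ Set.Ioo 0 l → η x = 0) ∧ l - ε ≤ ∫ x in Set.Ioo 0 l, η x := by
  -- The first entry makes the plateau long enough; `l / 4` keeps the radius positive when `ε` is
  -- large.
  let r : ℝ := max (l / 2 - ε / 2) (l / 4)
  have hr : 0 < r := by positivity
  have hrl : r < l / 2 := max_lt (by linarith) (by linarith)
  let g : ContDiffBump (l / 2) := ⟨r, l / 2, hr, hrl⟩
  have hgc : ContDiff ℝ ∞ g := g.contDiff
  refine ⟨g, hgc, g.hasCompactSupport, fun x => g.nonneg, fun x => g.le_one, fun x hx => ?_, ?_⟩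
  · rw [← Function.notMem_support, g.support_eq, Real.ball_eq_Ioo]
    simpa [g] using hx
  · have hsub : Set.Icc (l / 2 - r) (l / 2 + r) ⊆ Set.Ioo 0 l := fun x hx => by
      constructor <;> linarith [hx.1, hx.2]
    have hint : Integrable g := hgc.continuous.integrable_of_hasCompactSupport g.hasCompactSupport
    calc l - ε ≤ 2 * r := by linarith [le_max_left (l / 2 - ε / 2) (l / 4)]
      _ = ∫ x in Set.Icc (l / 2 - r) (l / 2 + r), (1 : ℝ) := by
          simp only [integral_const, MeasurableSet.univ, measureReal_restrict_apply,
            Set.univ_inter, Real.volume_real_Icc, smul_eq_mul, mul_one]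
          rw [max_eq_left (by linarith)]; ring
      _ = ∫ x in Set.Icc (l / 2 - r) (l / 2 + r), g x := by
          refine setIntegral_congr_fun measurableSet_Icc fun x hx => ?_
          exact (g.one_of_mem_closedBall (by rwa [Real.closedBall_eq_Icc])).symm
      _ ≤ _ := setIntegral_mono_set hint.integrableOn
          (Filter.Eventually.of_forall fun x => g.nonneg) hsub.eventuallyLE

/-! ### Product sets and product functions in the plane -/

/-- Allowing either order of the coordinates lets one strip estimate serve both axes. -/
theorem exists_measurableEquiv_coord_pair {i j : Fin 2} (hij : i ≠ j) :
    ∃ e : EuclideanSpace ℝ (Fin 2) ≃ᵐ ℝ × ℝ,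
      MeasurePreserving e ∧ ∀ x, e x = (x i, x j) := by
  have h0 : MeasurePreserving ((MeasurableEquiv.toLp 2 (Fin 2 → ℝ)).symm.trans
      (MeasurableEquiv.finTwoArrow (α := ℝ))) :=
    (volume_preserving_finTwoArrow ℝ).comp (PiLp.volume_preserving_ofLp (Fin 2))
  fin_cases i <;> fin_cases j
  · exact absurd rfl hij
  · exact ⟨_, h0, fun x => rfl⟩
  · refine ⟨_, (?_ : MeasurePreserving (((MeasurableEquiv.toLp 2 (Fin 2 → ℝ)).symm.trans
      (MeasurableEquiv.finTwoArrow (α := ℝ))).trans MeasurableEquiv.prodComm)), fun x => rfl⟩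
    exact Measure.measurePreserving_swap.comp h0
  · exact absurd rfl hij

theorem setIntegral_coord_mul {i j : Fin 2} (hij : i ≠ j) (f g : ℝ → ℝ) (A B : Set ℝ) :
    ∫ x in {x : EuclideanSpace ℝ (Fin 2) | x i ∈ A ∧ x j ∈ B}, f (x i) * g (x j) =
      (∫ t in A, f t) * ∫ t in B, g t := by
  obtain ⟨e, he, hex⟩ := exists_measurableEquiv_coord_pair hij
  have h := he.setIntegral_preimage_emb e.measurableEmbedding (fun z => f z.1 * g z.2) (A ×ˢ B)
  rw [Measure.volume_eq_prod, setIntegral_prod_mul] at h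
  rw [← h]
  have hs : e ⁻¹' A ×ˢ B = {x : EuclideanSpace ℝ (Fin 2) | x i ∈ A ∧ x j ∈ B} := by
    ext x; simp [hex]
  rw [hs]
  simp only [hex]

theorem volume_openRectangle (a b : ℝ) :
    volume (openRectangle a b) = ENNReal.ofReal a * ENNReal.ofReal b := by
  obtain ⟨e, he, hex⟩ := exists_measurableEquiv_coord_pair (i := 0) (j := 1) (by decide)
  have hs : e ⁻¹' (Set.Ioo 0 a ×ˢ Set.Ioo 0 b) = openRectangle a b := by
    ext x; simp [hex, openRectangle]
  rw [← hs, he.measure_preimage_emb e.measurableEmbedding, Measure.volume_eq_prod,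
    Measure.prod_prod]
  simp

theorem isOpen_openRectangle (a b : ℝ) : IsOpen (openRectangle a b) := by
  have h (i : Fin 2) : Continuous fun x : EuclideanSpace ℝ (Fin 2) => x i := by fun_prop
  exact (isOpen_Ioo.preimage (h 0)).inter (isOpen_Ioo.preimage (h 1))

theorem measurableSet_coord {i j : Fin 2} {A B : Set ℝ} (hA : MeasurableSet A)
    (hB : MeasurableSet B) :
    MeasurableSet {x : EuclideanSpace ℝ (Fin 2) | x i ∈ A ∧ x j ∈ B} := by
  have h (i : Fin 2) : Measurable fun x : EuclideanSpace ℝ (Fin 2) => x i := by fun_prop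
  exact (h i hA).inter (h j hB)

theorem isTestFunction_coord_mul {i j : Fin 2} (hij : i ≠ j) {s η : ℝ → ℝ}
    (hs : ContDiff ℝ ∞ s) (hsc : HasCompactSupport s)
    (hη : ContDiff ℝ ∞ η) (hηc : HasCompactSupport η) :
    IsTestFunction Set.univ fun x : EuclideanSpace ℝ (Fin 2) => s (x i) * η (x j) where
  contDiff := by
    have h (i : Fin 2) : ContDiff ℝ ∞ fun x : EuclideanSpace ℝ (Fin 2) => x i := by fun_prop
    exact (hs.comp (h i)).mul (hη.comp (h j))
  hasCompactSupport := by
    have hK : IsCompact (Set.univ.pi fun k : Fin 2 => if k = i then tsupport s else tsupport η) :=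
      isCompact_univ_pi fun k => by split_ifs <;> assumption
    refine HasCompactSupport.intro (hK.image (PiLp.continuous_toLp 2 fun _ : Fin 2 => ℝ))
      fun x hx => ?_
    by_contra hne
    refine hx ⟨x.ofLp, fun k _ => ?_, rfl⟩
    dsimp only
    split_ifs with hk
    · subst hk
      exact subset_tsupport _ (left_ne_zero_of_mul hne)
    · have : k = j := by omega
      subst this
      exact subset_tsupport _ (right_ne_zero_of_mul hne)
  tsupport_subset := Set.subset_univ _

theorem partialDeriv_coord_mul {i j : Fin 2} (hij : i ≠ j) {s η : ℝ → ℝ}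
    (hs : Differentiable ℝ s) (hη : Differentiable ℝ η) (x : EuclideanSpace ℝ (Fin 2)) :
    partialDeriv i (fun x : EuclideanSpace ℝ (Fin 2) => s (x i) * η (x j)) x =
      deriv s (x i) * η (x j) := by
  have h (k : Fin 2) : HasFDerivAt (fun x : EuclideanSpace ℝ (Fin 2) => x k)
      (EuclideanSpace.proj k : EuclideanSpace ℝ (Fin 2) →L[ℝ] ℝ) x :=
    (EuclideanSpace.proj k : EuclideanSpace ℝ (Fin 2) →L[ℝ] ℝ).hasFDerivAt
  have h1 := ((hs (x i)).hasDerivAt.comp_hasFDerivAt x (h i)).mul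
    ((hη (x j)).hasDerivAt.comp_hasFDerivAt x (h j))
  have h2 : fderiv ℝ (fun x : EuclideanSpace ℝ (Fin 2) => s (x i) * η (x j)) x = _ := h1.fderiv
  rw [partialDeriv, h2]
  simp [hij.symm, mul_comm]

/-! ### Weak derivatives of constants and `L²` norms -/

/-- Integration by parts against the constant 1 on the whole space. -/
theorem IsTestFunction.integral_partialDeriv {d : ℕ} {Ω : Set (EuclideanSpace ℝ (Fin d))}
    {φ : EuclideanSpace ℝ (Fin d) → ℝ} (hφ : IsTestFunction Ω φ) (i : Fin d) :
    ∫ x in Ω, partialDeriv i φ x = 0 := by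
  have hc : Continuous (partialDeriv i φ) :=
    (hφ.contDiff.continuous_fderiv (by simp)).clm_apply continuous_const
  have hs : HasCompactSupport (partialDeriv i φ) :=
    hφ.hasCompactSupport.fderiv_apply ℝ (EuclideanSpace.single i 1)
  have h0 : ∫ x in Ω, partialDeriv i φ x = ∫ x, partialDeriv i φ x := by
    refine setIntegral_eq_integral_of_forall_compl_eq_zero fun x hx => ?_
    rw [partialDeriv, fderiv_of_notMem_tsupport ℝ fun h => hx (hφ.tsupport_subset h)]
    rfl
  have key := integral_mul_fderiv_eq_neg_fderiv_mul_of_integrable (μ := volume)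
    (f := fun _ : EuclideanSpace ℝ (Fin d) => (1 : ℝ)) (g := φ)
    (v := EuclideanSpace.single i (1 : ℝ)) (by simp)
    (by simpa only [one_mul] using! hc.integrable_of_hasCompactSupport hs)
    (by simpa using hφ.contDiff.continuous.integrable_of_hasCompactSupport hφ.hasCompactSupport)
    (fun x _ => differentiableAt_const _)
    (fun x _ => hφ.contDiff.differentiable (by simp) x)
  rw [h0]
  simpa using! key

theorem hasWeakDeriv_zero_of_ae_eq_const {d : ℕ} {Ω : Set (EuclideanSpace ℝ (Fin d))} {i : Fin d}
    {f : L2 Ω} {c : ℂ} (hf : ∀ᵐ x ∂volume.restrict Ω, f x = c) : HasWeakDeriv Ω i f 0 := by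
  intro φ hφ
  have h1 : ∫ x in Ω, partialDeriv i φ x • f x = ∫ x in Ω, partialDeriv i φ x • c :=
    integral_congr_ae (by filter_upwards [hf] with x hx; rw [hx])
  have h2 : ∫ x in Ω, φ x • (0 : L2 Ω) x = 0 := by
    refine integral_eq_zero_of_ae ?_
    filter_upwards [Lp.coeFn_zero ℂ 2 (volume.restrict Ω)] with x hx
    rw [hx]
    exact smul_zero _
  rw [h1, h2, integral_smul_const, hφ.integral_partialDeriv, zero_smul, neg_zero]

theorem IsTestFunction.mono {d : ℕ} {Ω Ω' : Set (EuclideanSpace ℝ (Fin d))}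
    {φ : EuclideanSpace ℝ (Fin d) → ℝ} (hφ : IsTestFunction Ω φ) (h : Ω ⊆ Ω') :
    IsTestFunction Ω' φ :=
  ⟨hφ.contDiff, hφ.hasCompactSupport, hφ.tsupport_subset.trans h⟩

theorem memLp_volume {d : ℕ} (F : L2 (Set.univ : Set (EuclideanSpace ℝ (Fin d)))) :
    MemLp F 2 volume := by
  have h := Lp.memLp F
  simpa only [Measure.restrict_univ] using h

/-- A weak derivative vanishes where the function is constant. -/
theorem HasWeakDeriv.ae_eq_zero_of_ae_eq_const {d : ℕ} {Ω : Set (EuclideanSpace ℝ (Fin d))}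
    (hΩ : IsOpen Ω) {i : Fin d} {F G : L2 (Set.univ : Set (EuclideanSpace ℝ (Fin d)))}
    (h : HasWeakDeriv Set.univ i F G) {c : ℂ} (hF : ∀ᵐ x ∂volume.restrict Ω, F x = c) :
    ∀ᵐ x ∂volume.restrict Ω, G x = 0 := by
  rw [ae_restrict_iff' hΩ.measurableSet]
  refine hΩ.ae_eq_zero_of_integral_contDiff_smul_eq_zero
    (((memLp_volume G).locallyIntegrable one_le_two).locallyIntegrableOn Ω) fun φ hφ hc hs => ?_
  have ht : IsTestFunction Ω φ := ⟨hφ, hc, hs⟩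
  have hk := h φ (ht.mono (Set.subset_univ _))
  simp only [Measure.restrict_univ] at hk
  rw [← neg_eq_zero, ← hk]
  have h0 : ∫ x, partialDeriv i φ x • F x = ∫ x in Ω, partialDeriv i φ x • F x := by
    refine (setIntegral_eq_integral_of_forall_compl_eq_zero fun x hx => ?_).symm
    rw [partialDeriv, fderiv_of_notMem_tsupport ℝ fun h => hx (hs h)]
    exact zero_smul _ _
  have h1 : ∫ x in Ω, partialDeriv i φ x • F x = ∫ x in Ω, partialDeriv i φ x • c :=
    integral_congr_ae (by filter_upwards [hF] with x hx; rw [hx])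
  rw [h0, h1, integral_smul_const, ht.integral_partialDeriv, zero_smul]

theorem norm_sq_eq_integral {d : ℕ} (F : L2 (Set.univ : Set (EuclideanSpace ℝ (Fin d)))) :
    ‖F‖ ^ 2 = ∫ x, ‖F x‖ ^ 2 := by
  have h := L2.inner_def (𝕜 := ℂ) F F
  simp only [inner_self_eq_norm_sq_to_K, Measure.restrict_univ] at h
  have h2 : ∫ x, ((‖F x‖ : ℂ)) ^ 2 = ((∫ x, ‖F x‖ ^ 2 : ℝ) : ℂ) := by
    rw [← integral_complex_ofReal]; simp
  exact Complex.ofReal_injective ((Complex.ofReal_pow _ _).trans (h.trans h2))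

/-! ### Energy on the half-strips -/

/-- The energy of a Sobolev function on the two half-strips adjacent to a rectangle on which it
is constant, tested against a product function. -/
theorem mul_setIntegral_le_strip_energy {i j : Fin 2} (hij : i ≠ j) {p q K : ℝ} (hp : 0 < p)
    {F G : L2 (Set.univ : Set (EuclideanSpace ℝ (Fin 2)))} (hG : HasWeakDeriv Set.univ i F G)
    {c : ℝ} (hF : ∀ᵐ x ∂volume.restrict
      {x : EuclideanSpace ℝ (Fin 2) | x i ∈ Set.Ioo 0 p ∧ x j ∈ Set.Ioo 0 q}, F x = c)
    {s η : ℝ → ℝ} (hs : ContDiff ℝ ∞ s) (hsc : HasCompactSupport s) (hs2 : s p - s 0 = 2)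
    (hsK : ∫ t in (Set.Ioo 0 p)ᶜ, (s t ^ 2 + deriv s t ^ 2) ≤ K)
    (hη : ContDiff ℝ ∞ η) (hηc : HasCompactSupport η) (hη0 : ∀ t, 0 ≤ η t) (hη1 : ∀ t, η t ≤ 1)
    (hηq : ∀ t, t ∉ Set.Ioo 0 q → η t = 0) :
    c ^ 2 * (4 - K) * ∫ t in Set.Ioo 0 q, η t ≤
      ∫ x in {x : EuclideanSpace ℝ (Fin 2) | x i ∈ (Set.Ioo 0 p)ᶜ ∧ x j ∈ Set.Ioo 0 q},
        (‖F x‖ ^ 2 + ‖G x‖ ^ 2) := by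
  set Ω := {x : EuclideanSpace ℝ (Fin 2) | x i ∈ Set.Ioo 0 p ∧ x j ∈ Set.Ioo 0 q}
  set S := {x : EuclideanSpace ℝ (Fin 2) | x i ∈ (Set.Ioo 0 p)ᶜ ∧ x j ∈ Set.Ioo 0 q}
  have hΩm : MeasurableSet Ω := measurableSet_coord measurableSet_Ioo measurableSet_Ioo
  have hSm : MeasurableSet S := measurableSet_coord measurableSet_Ioo.compl measurableSet_Ioo
  have hΩo : IsOpen Ω := by
    have h (i : Fin 2) : Continuous fun x : EuclideanSpace ℝ (Fin 2) => x i := by fun_prop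
    exact (isOpen_Ioo.preimage (h i)).inter (isOpen_Ioo.preimage (h j))
  have hG0 := hG.ae_eq_zero_of_ae_eq_const hΩo hF
  let φ : EuclideanSpace ℝ (Fin 2) → ℝ := fun x => s (x i) * η (x j)
  let ψ : EuclideanSpace ℝ (Fin 2) → ℝ := fun x => deriv s (x i) * η (x j)
  have hφ : IsTestFunction Set.univ φ := isTestFunction_coord_mul hij hs hsc hη hηc
  have hψ : partialDeriv i φ = ψ :=
    funext (partialDeriv_coord_mul hij (hs.differentiable (by simp)) (hη.differentiable (by simp)))
  have hψc : Continuous ψ := by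
    rw [← hψ]
    exact (hφ.contDiff.continuous_fderiv (by simp)).clm_apply continuous_const
  have hψs : HasCompactSupport ψ := by
    rw [← hψ]
    exact hφ.hasCompactSupport.fderiv_apply ℝ (EuclideanSpace.single i 1)
  have hi1 := hφ.integrable_partialDeriv_smul i F
  have hi2 := hφ.integrable_smul G
  have hw := hG φ hφ
  simp only [Measure.restrict_univ, hψ] at hi1 hi2 hw
  let h : EuclideanSpace ℝ (Fin 2) → ℝ := fun x => ψ x * (F x).re + φ x * (G x).re
  have hre : h = fun x => RCLike.re (ψ x • F x + φ x • G x) := by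
    funext x; simp [h]
  have hhi : Integrable h := by rw [hre]; exact (hi1.add hi2).re
  have hh0 : ∫ x, h x = 0 := by
    have h1 : ∫ x, RCLike.re (ψ x • F x + φ x • G x) =
        RCLike.re (∫ x, (ψ x • F x + φ x • G x)) := integral_re (hi1.add hi2)
    rw [hre, h1, integral_add hi1 hi2, hw]
    simp
  -- Both `φ` and `ψ` carry the factor `η (x j)`, so `h` vanishes off the full strip.
  have hsplit : ∫ x, h x = (∫ x in Ω, h x) + ∫ x in S, h x := by
    rw [← setIntegral_union (Set.disjoint_left.2 fun x hx hx' => hx'.1 hx.1) hSm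
      hhi.integrableOn hhi.integrableOn]
    refine (setIntegral_eq_integral_of_forall_compl_eq_zero fun x hx => ?_).symm
    have hxj : x j ∉ Set.Ioo 0 q := fun hxj => hx <| by
      by_cases hxi : x i ∈ Set.Ioo 0 p
      · exact Or.inl ⟨hxi, hxj⟩
      · exact Or.inr ⟨hxi, hxj⟩
    simp [h, φ, ψ, hηq _ hxj]
  have hFTC : ∫ t in Set.Ioo 0 p, deriv s t = 2 := by
    rw [← integral_Ioc_eq_integral_Ioo, ← intervalIntegral.integral_of_le hp.le,
      intervalIntegral.integral_deriv_eq_sub (fun x _ => hs.differentiable (by simp) x)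
        ((hs.continuous_deriv (by simp)).intervalIntegrable _ _), hs2]
  -- On the rectangle `F = c` and `G = 0`, so only the jump of `s` is seen.
  have hΩint : ∫ x in Ω, h x = c * (2 * ∫ t in Set.Ioo 0 q, η t) := by
    rw [← hFTC, ← setIntegral_coord_mul hij, ← integral_const_mul]
    refine integral_congr_ae ?_
    filter_upwards [hF, hG0] with x hx hx'
    simp [h, ψ, hx, hx', mul_comm]
  have hFG : Integrable fun x => ‖F x‖ ^ 2 + ‖G x‖ ^ 2 :=
    ((memLp_volume F).norm.integrable_sq).add ((memLp_volume G).norm.integrable_sq)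
  have hφψ : Integrable fun x => φ x ^ 2 + ψ x ^ 2 :=
    (hφ.contDiff.continuous.memLp_of_hasCompactSupport hφ.hasCompactSupport).integrable_sq.add
      (hψc.memLp_of_hasCompactSupport hψs).integrable_sq
  -- The left side will equal `4 c² ∫ η`. Equality would require `F = -c ψ` and `G = -c φ`, which
  -- the exponential profile satisfies up to the cutoffs.
  have hYoung : ∫ x in S, -(2 * c) * h x ≤
      (∫ x in S, (‖F x‖ ^ 2 + ‖G x‖ ^ 2)) + c ^ 2 * ∫ x in S, (φ x ^ 2 + ψ x ^ 2) := by
    rw [← integral_const_mul, ← integral_add hFG.integrableOn (hφψ.integrableOn.const_mul _)]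
    refine setIntegral_mono (hhi.integrableOn.const_mul _)
      (hFG.integrableOn.add (hφψ.integrableOn.const_mul _)) fun x => ?_
    have h1 : (F x).re ^ 2 ≤ ‖F x‖ ^ 2 := by
      rw [← sq_abs]; gcongr; exact Complex.abs_re_le_norm _
    have h2 : (G x).re ^ 2 ≤ ‖G x‖ ^ 2 := by
      rw [← sq_abs]; gcongr; exact Complex.abs_re_le_norm _
    simp only [h]
    nlinarith [sq_nonneg (c * ψ x + (F x).re), sq_nonneg (c * φ x + (G x).re)]
  -- Makes the same factor `∫ η` appear on both sides of the estimate.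
  have hη2 : ∫ t in Set.Ioo 0 q, η t ^ 2 ≤ ∫ t in Set.Ioo 0 q, η t := by
    refine setIntegral_mono ?_ ?_ fun t => ?_
    · exact (hη.continuous.memLp_of_hasCompactSupport hηc).integrable_sq.integrableOn
    · exact (hη.continuous.integrable_of_hasCompactSupport hηc).integrableOn
    · nlinarith [hη0 t, hη1 t]
  have hI0 : 0 ≤ ∫ t in Set.Ioo 0 q, η t ^ 2 := integral_nonneg fun t => sq_nonneg _
  have hK0 : 0 ≤ K := le_trans (integral_nonneg fun t => by positivity) hsK
  have hφψK : ∫ x in S, (φ x ^ 2 + ψ x ^ 2) ≤ K * ∫ t in Set.Ioo 0 q, η t := by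
    calc _ = ∫ x in S, (s (x i) ^ 2 + deriv s (x i) ^ 2) * η (x j) ^ 2 := by
          congr 1; funext x; simp only [φ, ψ]; ring
      _ = (∫ t in (Set.Ioo 0 p)ᶜ, (s t ^ 2 + deriv s t ^ 2)) * ∫ t in Set.Ioo 0 q, η t ^ 2 :=
          setIntegral_coord_mul hij (fun t => s t ^ 2 + deriv s t ^ 2) (fun t => η t ^ 2) _ _
      _ ≤ K * ∫ t in Set.Ioo 0 q, η t := by gcongr
  rw [integral_const_mul] at hYoung
  have hS : ∫ x in S, h x = -(c * (2 * ∫ t in Set.Ioo 0 q, η t)) := by linarith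
  rw [hS] at hYoung
  have := mul_le_mul_of_nonneg_left hφψK (sq_nonneg c)
  linarith

theorem strip_energy_ge {i j : Fin 2} (hij : i ≠ j) {p q : ℝ} (hp : 0 < p) (hq : 0 < q)
    {F G : L2 (Set.univ : Set (EuclideanSpace ℝ (Fin 2)))} (hG : HasWeakDeriv Set.univ i F G)
    {c : ℝ} (hF : ∀ᵐ x ∂volume.restrict
      {x : EuclideanSpace ℝ (Fin 2) | x i ∈ Set.Ioo 0 p ∧ x j ∈ Set.Ioo 0 q}, F x = c) :
    c ^ 2 * (2 * q) ≤
      ∫ x in {x : EuclideanSpace ℝ (Fin 2) | x i ∈ (Set.Ioo 0 p)ᶜ ∧ x j ∈ Set.Ioo 0 q},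
        (‖F x‖ ^ 2 + ‖G x‖ ^ 2) := by
  -- Here `2 - ε` is `4 - K` with `K = 2 + ε`, and `q - ε` bounds `∫ η` from below.
  have hlim : Filter.Tendsto (fun ε : ℝ => c ^ 2 * (2 - ε) * (q - ε)) (nhdsWithin 0 (Set.Ioi 0))
      (nhds (c ^ 2 * (2 * q))) := by
    have hc : Continuous fun ε : ℝ => c ^ 2 * (2 - ε) * (q - ε) := by fun_prop
    refine (hc.tendsto' 0 _ ?_).mono_left nhdsWithin_le_nhds
    ring
  refine le_of_tendsto hlim ?_
  filter_upwards [Ioo_mem_nhdsGT two_pos] with ε hε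
  obtain ⟨s, hs, hsc, hs2, hsK⟩ := exists_profile hp hε.1
  obtain ⟨η, hη, hηc, hη0, hη1, hηq, hηI⟩ := exists_cutoff hq hε.1
  refine le_trans ?_ (mul_setIntegral_le_strip_energy hij hp hG hF hs hsc hs2 hsK hη hηc hη0 hη1
    hηq)
  have : 0 ≤ c ^ 2 * (2 - ε) := mul_nonneg (sq_nonneg _) (by linarith [hε.2])
  calc _ ≤ c ^ 2 * (2 - ε) * ∫ t in Set.Ioo 0 q, η t := by gcongr
    _ = _ := by ring

/-! ### The lower bound for extensions of constants -/

/-- A Sobolev function on the plane that is constant on a rectangle has large `H¹` norm. -/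
theorem h1Norm_sq_ge_of_ae_eq_const {a b : ℝ} (ha : 0 < a) (hb : 0 < b)
    (F : H1 (Set.univ : Set (EuclideanSpace ℝ (Fin 2)))) {c : ℝ}
    (hF : ∀ᵐ x ∂volume.restrict (openRectangle a b),
      (F : L2 (Set.univ : Set (EuclideanSpace ℝ (Fin 2)))) x = c) :
    c ^ 2 * (a * b + 2 * (a + b)) ≤ h1Norm F ^ 2 := by
  set f : L2 (Set.univ : Set (EuclideanSpace ℝ (Fin 2))) := F.1
  have hsq (g : L2 (Set.univ : Set (EuclideanSpace ℝ (Fin 2)))) :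
      Integrable fun x => ‖g x‖ ^ 2 := (memLp_volume g).norm.integrable_sq
  have hfg (i : Fin 2) := hasWeakDeriv_weakDeriv F i
  have h0 := strip_energy_ge (i := 0) (j := 1) (by decide) ha hb (hfg 0) hF
  have h1 := strip_energy_ge (i := 1) (j := 0) (p := b) (q := a) (c := c) (by decide) hb ha (hfg 1)
    (by simpa only [openRectangle, and_comm] using hF)
  rw [integral_add (hsq _).integrableOn (hsq _).integrableOn] at h0 h1
  rw [h1Norm, Real.sq_sqrt (by positivity), Fin.sum_univ_two]
  simp only [norm_sq_eq_integral]
  set S₀ := {x : EuclideanSpace ℝ (Fin 2) | x 0 ∈ (Set.Ioo 0 a)ᶜ ∧ x 1 ∈ Set.Ioo 0 b}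
  set S₁ := {x : EuclideanSpace ℝ (Fin 2) | x 1 ∈ (Set.Ioo 0 b)ᶜ ∧ x 0 ∈ Set.Ioo 0 a}
  have hS₀ : MeasurableSet S₀ := measurableSet_coord measurableSet_Ioo.compl measurableSet_Ioo
  have hS₁ : MeasurableSet S₁ := measurableSet_coord measurableSet_Ioo.compl measurableSet_Ioo
  have hle (g : L2 (Set.univ : Set (EuclideanSpace ℝ (Fin 2))))
      (S : Set (EuclideanSpace ℝ (Fin 2))) : ∫ x in S, ‖g x‖ ^ 2 ≤ ∫ x, ‖g x‖ ^ 2 :=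
    setIntegral_le_integral (hsq g) (Filter.Eventually.of_forall fun x => by positivity)
  have hR : ∫ x in openRectangle a b, ‖f x‖ ^ 2 = c ^ 2 * (a * b) := by
    have : ∫ x in openRectangle a b, ‖f x‖ ^ 2 = ∫ x in openRectangle a b, c ^ 2 :=
      integral_congr_ae (by filter_upwards [hF] with x hx; simp [hx])
    rw [this, setIntegral_const, measureReal_def, volume_openRectangle, ENNReal.toReal_mul,
      ENNReal.toReal_ofReal ha.le, ENNReal.toReal_ofReal hb.le, smul_eq_mul, mul_comm]
  -- The three regions are disjoint, so no mass of `f` is counted twice; the corner regions are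
  -- dropped. Each derivative is used only on the strips in its own direction.
  have hsum : (∫ x in openRectangle a b, ‖f x‖ ^ 2) + (∫ x in S₀, ‖f x‖ ^ 2) +
      (∫ x in S₁, ‖f x‖ ^ 2) ≤ ∫ x, ‖f x‖ ^ 2 := by
    rw [← setIntegral_union (Set.disjoint_left.2 fun x hx hx' => hx'.1 hx.1) hS₀
        (hsq f).integrableOn (hsq f).integrableOn,
      ← setIntegral_union (Set.disjoint_left.2 fun x hx hx' => ?_) hS₁
        (hsq f).integrableOn (hsq f).integrableOn]
    · exact hle f _
    · rcases hx with hx | hx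
      · exact hx'.1 hx.2
      · exact hx'.1 hx.2
  have e0 := hle (weakDeriv F 0) S₀
  have e1 := hle (weakDeriv F 1) S₁
  linarith

theorem mainTheorem6 (a b : ℝ) (ha : 0 < a) (hb : 0 < b) :
    ENNReal.ofReal (Real.sqrt (1 + 2 * (1 / a + 1 / b))) ≤
      minExtensionNorm (openRectangle a b) := by
  set Ω := openRectangle a b
  refine le_iInf₂ fun E hE => ?_
  have hvol : volume Ω = ENNReal.ofReal a * ENNReal.ofReal b := volume_openRectangle a b
  have hfin : IsFiniteMeasure (volume.restrict Ω) :=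
    ⟨by rw [Measure.restrict_apply_univ, hvol]; exact ENNReal.mul_lt_top (by simp) (by simp)⟩
  have hne : NeZero (volume.restrict Ω) := ⟨fun h => by
    have h' := Measure.restrict_eq_zero.1 h
    rw [hvol] at h'
    simp [ha.not_ge, hb.not_ge] at h'⟩
  have hab : 0 < a * b := mul_pos ha hb
  -- Normalises the constant function to have norm 1.
  let c : ℝ := (Real.sqrt (a * b))⁻¹
  have hc2 : c ^ 2 * (a * b) = 1 := by
    simp only [c]
    rw [inv_pow, Real.sq_sqrt hab.le, inv_mul_cancel₀ hab.ne']
  let u : L2 Ω := Lp.const 2 (volume.restrict Ω) (c : ℂ)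
  have hu : ∀ᵐ x ∂volume.restrict Ω, u x = c := Lp.coeFn_const 2 (volume.restrict Ω) (c : ℂ)
  have hw (i : Fin 2) : HasWeakDeriv Ω i u 0 := hasWeakDeriv_zero_of_ae_eq_const hu
  let f : H1 Ω := ⟨u, fun i => ⟨0, hw i⟩⟩
  have hwf (i : Fin 2) : weakDeriv f i = 0 :=
    (hasWeakDeriv_weakDeriv f i).unique (isOpen_openRectangle a b) (hw i)
  have hnu : ‖u‖ = 1 := by
    have h : ‖u‖ = _ := Lp.norm_const 2 (volume.restrict Ω) (c : ℂ) (by simp)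
    have hv : (volume.restrict Ω).real Set.univ = a * b := by
      rw [measureReal_def, Measure.restrict_apply_univ, hvol, ENNReal.toReal_mul,
        ENNReal.toReal_ofReal ha.le, ENNReal.toReal_ofReal hb.le]
    have hcn : ‖(c : ℂ)‖ = c := by
      rw [Complex.norm_real, Real.norm_of_nonneg (by positivity)]
    rw [h, hv, hcn, ENNReal.toReal_ofNat, ← Real.sqrt_eq_rpow]
    exact inv_mul_cancel₀ (Real.sqrt_pos.2 hab).ne'
  have hnf : h1Norm f = 1 := by
    have : ((f : H1 Ω) : L2 Ω) = u := rfl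
    simp [h1Norm, hwf, this, hnu]
  refine le_trans (ENNReal.ofReal_le_ofReal ?_) (le_iSup₂_of_le f hnf le_rfl)
  have hEf : ∀ᵐ x ∂volume.restrict Ω,
      (E f : L2 (Set.univ : Set (EuclideanSpace ℝ (Fin 2)))) x = c := by
    filter_upwards [hE.restrict_eq f, hu] with x hx hx'
    exact hx.trans hx'
  have hkey := h1Norm_sq_ge_of_ae_eq_const ha hb (E f) hEf
  refine Real.sqrt_le_iff.2 ⟨Real.sqrt_nonneg _, le_trans (le_of_eq ?_) hkey⟩
  have : c ^ 2 = 1 / (a * b) := by rw [eq_div_iff hab.ne', hc2]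
  rw [this]
  field_simp
  ring
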